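/- For positive integers $H,d_1,d_2,k,v$, let a weight set consist of matrices $W_Q^{(j)},W_K^{(j)}\in\mathbb R^{d_1\times k}$, $W_V^{(j)}\in\mathbb R^{d_1\times v}$, $W_O^{(j)}\in\mathbb R^{v\times d_2}$ for $j=1,\dots,H$. For an input $X=[x_1,\dots,x_T]^\top\in\mathbb R^{T\times d_1}$ and an attention mask $a\in\{0,1\}^{T\times T}$ with at least one $1$ in each row, multi-head attention (MHA) with these weights has the $i$-th token output $$\mathrm{Attn}_W(x_i;X,a)=\sum_{j=1}^H \mathrm{softmax}\Big(\tfrac{1}{\sqrt k}\,(x_i^\top W_Q^{(j)})(XW_K^{(j)})^\top;\,a_i\Big)\,XW_V^{(j)}\,W_O^{(j)}\in\mathbb R^{1\times d_2},$$ $$\mathrm{softmax}(s;a_i)_l=\frac{a_{i,l}e^{s_l}}{\sum_{m=1}^T a_{i,m}e^{s_m}} .$$ Write $\|\cdot\|$ for the Euclidean norm of vectors and the spectral norm of matrices, and $\odot$ for the entrywise product. **Theorem.** There is a universal constant $C>0$ such that the following holds. Let $H,d_1,d_2,d_K,d_V$ be positive integers, $0<\varepsilon<1$, $\alpha\ge\max(\sqrt{d_1},\sqrt{d_2})$,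 and let $n_K,n_V$ be integers with $$n_K\ \ge\ d_1\,C\log\!\Big(\frac{8H\alpha^3d_1^{3/2}}{\varepsilon}\Big),\qquad n_V\ \ge\ d_1\,C\log\!\Big(\frac{2H\alpha d_1\sqrt{d_2}}{\varepsilon}\Big).$$ Let $W$ be a (target) weight set with key and value dimensions $d_K,d_V$ such that $\|W_Q^{(j)}\|,\|W_K^{(j)}\|,\|W_V^{(j)}\|,\|W_O^{(j)}\|\le 1$ for all $j$. Let $\tilde W$ be a random (source) weight set with key and value dimensions $n_K,n_V$ whose entries are all independent, those of $\tilde W_Q^{(j)},\tilde W_K^{(j)}$ uniform on $[-n_K^{1/4},n_K^{1/4}]$ and those of $\tilde W_V^{(j)},\tilde W_O^{(j)}$ uniform on $[-1,1]$. Then, with probability at least $1-\varepsilon$, there are binary masks $M_Q^{(j)},M_K^{(j)},M_V^{(j)},M_O^{(j)}$ ($j=1,\dots,H$), with entries in $\{0,1\}$ and the shapes of the corresponding source matrices, such that the pruned source $\tilde W\odot M=\{\tilde W_Q^{(j)}\odot M_Q^{(j)},\tilde W_K^{(j)}\odot M_K^{(j)},\tilde W_V^{(j)}\odot M_V^{(j)},\tilde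 W_O^{(j)}\odot M_O^{(j)}\}_{j=1}^H$ satisfies, for every sequence length $T$, every input $X\in\mathbb R^{T\times d_1}$ with $\|x_i\|\le\alpha$ for all $i$, and every attention mask $a\in\{0,1\}^{T\times T}$ with at least one $1$ in each row, $$\max_{1\le i\le T}\big\|\mathrm{Attn}_{\tilde W\odot M}(x_i;X,a)-\mathrm{Attn}_W(x_i;X,a)\big\|\le\varepsilon .$$ -/

import Mathlib

open MeasureTheory ProbabilityTheory
open scoped Matrix Matrix.Norms.L2Operator

/-- The weights of an `H`-head attention mechanism with input dimension `d₁`, output dimension `d₂`,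
key dimension `k` and value dimension `v`. The output projection is partitioned into one block
per head. -/
@[ext]
structure MHAWeights (H d₁ d₂ k v : ℕ) where
  /-- query projections -/
  WQ : Fin H → Matrix (Fin d₁) (Fin k) ℝ
  /-- key projections -/
  WK : Fin H → Matrix (Fin d₁) (Fin k) ℝ
  /-- value projections -/
  WV : Fin H → Matrix (Fin d₁) (Fin v) ℝ
  /-- blocks of the output projection -/
  WO : Fin H → Matrix (Fin v) (Fin d₂) ℝ

/-- Positions of the scalar entries of a weight set. -/
inductive MHAIndex (H d₁ d₂ k v : ℕ) : Type
  | query (j : Fin H) (r : Fin d₁) (c : Fin k)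
  | key (j : Fin H) (r : Fin d₁) (c : Fin k)
  | value (j : Fin H) (r : Fin d₁) (c : Fin v)
  | output (j : Fin H) (r : Fin v) (c : Fin d₂)

namespace MHAWeights

variable {H d₁ d₂ k v : ℕ}

/-- The scalar entry of a weight set at a given position. -/
def entry (W : MHAWeights H d₁ d₂ k v) : MHAIndex H d₁ d₂ k v → ℝ
  | .query j r c => W.WQ j r c
  | .key j r c => W.WK j r c
  | .value j r c => W.WV j r c
  | .output j r c => W.WO j r c

/-- All entries are `0` or `1`: such a weight set serves as a family of binary pruning masks. -/
def IsBinary (M : MHAWeights H d₁ d₂ k v) : Prop :=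
  ∀ e, M.entry e = 0 ∨ M.entry e = 1

/-- Pruning: the Hadamard product of every weight matrix with the mask of the same shape. -/
def prune (W M : MHAWeights H d₁ d₂ k v) : MHAWeights H d₁ d₂ k v where
  WQ j := W.WQ j ⊙ M.WQ j
  WK j := W.WK j ⊙ M.WK j
  WV j := W.WV j ⊙ M.WV j
  WO j := W.WO j ⊙ M.WO j

/-- Every projection of every head has spectral norm (`ℓ²` operator norm) at most `1`. -/
def SpectralNormLeOne (W : MHAWeights H d₁ d₂ k v) : Prop :=
  ∀ j, ‖W.WQ j‖ ≤ 1 ∧ ‖W.WK j‖ ≤ 1 ∧ ‖W.WV j‖ ≤ 1 ∧ ‖W.WO j‖ ≤ 1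

end MHAWeights

/-- A `T × T` binary attention mask in which every token attends to at least one token. -/
def IsAttentionMask {T : ℕ} (a : Matrix (Fin T) (Fin T) ℝ) : Prop :=
  (∀ i j, a i j = 0 ∨ a i j = 1) ∧ ∀ i, ∃ j, a i j = 1

/-- The softmax of the scores `s` under the attention mask `a`. -/
noncomputable def maskedSoftmax {T : ℕ} (s a : Fin T → ℝ) : Fin T → ℝ :=
  fun j => a j * Real.exp (s j) / ∑ l, a l * Real.exp (s l)

namespace MHAWeights

variable {H d₁ d₂ k v T : ℕ}

/-- The output of the `j`-th head at the `i`-th token of the input `X`, whose rows are the tokens: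
`softmax (qᵢ Kᵀ / √k ; aᵢ) V`. -/
noncomputable def head (W : MHAWeights H d₁ d₂ k v) (X : Matrix (Fin T) (Fin d₁) ℝ)
    (a : Matrix (Fin T) (Fin T) ℝ) (i : Fin T) (j : Fin H) : Fin v → ℝ :=
  maskedSoftmax ((Real.sqrt k)⁻¹ • ((X i ᵥ* W.WQ j) ᵥ* (X * W.WK j)ᵀ)) (a i) ᵥ* (X * W.WV j)

/-- The output of multi-head attention at the `i`-th token, with its Euclidean norm. -/
noncomputable def attn (W : MHAWeights H d₁ d₂ k v) (X : Matrix (Fin T) (Fin d₁) ℝ)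
    (a : Matrix (Fin T) (Fin T) ℝ) (i : Fin T) : EuclideanSpace ℝ (Fin d₂) :=
  WithLp.toLp 2 (∑ j, W.head X a i j ᵥ* W.WO j)

/-- The interval `[-r, r]` on which an entry of the random source weights is uniform: `r = k ^ (1/4)`
for query and key entries, `r = 1` for value and output entries. -/
noncomputable def initInterval : MHAIndex H d₁ d₂ k v → Set ℝ
  | .query _ _ _ => Set.Icc (-(k : ℝ) ^ (1 / 4 : ℝ)) ((k : ℝ) ^ (1 / 4 : ℝ))
  | .key _ _ _ => Set.Icc (-(k : ℝ) ^ (1 / 4 : ℝ)) ((k : ℝ) ^ (1 / 4 : ℝ))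
  | .value _ _ _ => Set.Icc (-1) 1
  | .output _ _ _ => Set.Icc (-1) 1

/-- `W` is a random weight set whose entries are jointly independent, each uniformly distributed
on its interval. -/
def IsRandomInit {Ω : Type*} [MeasurableSpace Ω] (P : Measure Ω)
    (W : Ω → MHAWeights H d₁ d₂ k v) : Prop :=
  iIndepFun (fun e ω => (W ω).entry e) P ∧
    ∀ e, pdf.IsUniform (fun ω => (W ω).entry e) (initInterval e) P volume

end MHAWeights

/-! A head depends on its weights only through the score form `WQ * WKᵀ / √k` and the output map `WV
* WO` (`head_vecMul_WO`), so it suffices to make every entry of these two products close to the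
target's. Softmax weights move multiplicatively under small score changes, which gives an error
bound free of the sequence length (`norm_attn_sub_attn_le`).

To make the entries of a product independently adjustable, columns are divided into `d₁` groups and
row `r` of the first factor is kept only on group `r`. Entry `(r, s)` then becomes a subset sum of
products of two independent uniforms over group `r`, and the masks of the second factor choose the
subsets without conflict (`sum_ite_mul_ite_eq_sum`).

The probabilistic core is a random subset sum theorem (`measure_no_subsetSum_le`): of order `log L`
summands reach a given point of `[-1, 1]` within `1 / L`, except with probability `1 / L`. Let `A`
be the set of points approximable so far in a fixed interval. Averaged over the next summand, `A`
grows by an amount proportional to `|A|` times the measure missed, so the expected odds of missing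
`A` contract by a constant factor. Markov's inequality makes the missed measure small, hence every
gap short. A union bound over heads and entries concludes. -/

/-! ### Growth of the set of approximate subset sums -/

/-- The interval in which approximate subset sums are tracked. -/
def trackInterval : Set ℝ := Set.Icc (-(1 / 4)) (1 / 4)

/-- The points of the tracking interval outside `A` that are reached from `A` by a shift by `x`. -/
def newPoints (A : Set ℝ) (x : ℝ) : Set ℝ := {y | y ∈ trackInterval \ A ∧ y - x ∈ A}

/-- The odds against a uniform point of the tracking interval to lie in `A`. -/
noncomputable def missOdds (A : Set ℝ) : ℝ := 1 / 2 / volume.real A - 1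

/-- The law `ν` dominates an eighth of Lebesgue measure on `[-1/2, 1/2]`. -/
def DominatesLebesgue (ν : Measure ℝ) : Prop :=
  ∀ B : Set ℝ, MeasurableSet B → B ⊆ Set.Icc (-(1 / 2)) (1 / 2) → volume B ≤ 8 * ν B

lemma measurableSet_trackInterval : MeasurableSet trackInterval := measurableSet_Icc

lemma volume_trackInterval : volume trackInterval = ENNReal.ofReal (1 / 2) := by
  rw [trackInterval, Real.volume_Icc]; norm_num

lemma volumeReal_trackInterval : volume.real trackInterval = 1 / 2 := by
  rw [Measure.real, volume_trackInterval, ENNReal.toReal_ofReal (by norm_num)]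

lemma volume_ne_top_of_subset_trackInterval {A : Set ℝ} (hA : A ⊆ trackInterval) :
    volume A ≠ ⊤ :=
  ne_top_of_le_ne_top (by rw [volume_trackInterval]; exact ENNReal.ofReal_ne_top)
    (measure_mono hA)

lemma measurableSet_prod_newPoints {A : Set ℝ} (hA : MeasurableSet A) :
    MeasurableSet {p : ℝ × ℝ | p.2 ∈ newPoints A p.1} :=
  (measurable_snd (measurableSet_trackInterval.diff hA)).inter
    ((measurable_snd.sub measurable_fst) hA)

/-- Fubini: for `y` outside `A`, the shifts that reach `y` form `y - A`, a reflected copy of `A`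
inside `[-1/2, 1/2]`, so `ν` gives it at least `volume A / 8`. -/
lemma volume_mul_volume_diff_le {ν : Measure ℝ} [IsProbabilityMeasure ν]
    (hν : DominatesLebesgue ν) {A : Set ℝ} (hA : MeasurableSet A) (hAI : A ⊆ trackInterval) :
    volume A * volume (trackInterval \ A) ≤ 8 * ∫⁻ x, volume (newPoints A x) ∂ν := by
  have hD := measurableSet_prod_newPoints hA
  have h1 : ∫⁻ x, volume (newPoints A x) ∂ν =
      ∫⁻ y, ν ((fun x => (x, y)) ⁻¹' {p : ℝ × ℝ | p.2 ∈ newPoints A p.1}) := by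
    rw [← Measure.prod_apply_symm hD, Measure.prod_apply hD]
    rfl
  rw [h1, ← lintegral_const_mul _ (measurable_measure_prodMk_right hD)]
  calc volume A * volume (trackInterval \ A)
      = ∫⁻ y in trackInterval \ A, volume A := by rw [lintegral_const, Measure.restrict_apply_univ]
    _ ≤ ∫⁻ y in trackInterval \ A,
          8 * ν ((fun x => (x, y)) ⁻¹' {p : ℝ × ℝ | p.2 ∈ newPoints A p.1}) := by
        refine setLIntegral_mono' (measurableSet_trackInterval.diff hA) fun y hy => ?_
        have h2 : (fun x => (x, y)) ⁻¹' {p : ℝ × ℝ | p.2 ∈ newPoints A p.1}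
            = (fun x => y - x) ⁻¹' A := by
          ext x; simp only [newPoints, Set.mem_preimage, Set.mem_ofPred_eq]; tauto
        rw [h2]
        have h3 : volume ((fun x => y - x) ⁻¹' A) = volume A :=
          (Measure.measurePreserving_sub_left volume y).measure_preimage hA.nullMeasurableSet
        rw [← h3]
        refine hν _ ((measurable_const.sub measurable_id) hA) fun x hx => ?_
        have h4 := hAI hx
        have h5 := hy.1
        simp only [trackInterval, Set.mem_Icc] at h4 h5 ⊢
        constructor <;> linarith
    _ ≤ _ := setLIntegral_le_lintegral _ _

lemma volume_newPoints_le {A : Set ℝ} (hA : MeasurableSet A) (x : ℝ) :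
    volume (newPoints A x) ≤ volume A := by
  rw [← (measurePreserving_sub_right volume x).measure_preimage hA.nullMeasurableSet]
  exact measure_mono fun y hy => hy.2

lemma measurableSet_newPoints {A : Set ℝ} (hA : MeasurableSet A) (x : ℝ) :
    MeasurableSet (newPoints A x) :=
  (measurableSet_trackInterval.diff hA).inter ((measurable_id.sub measurable_const) hA)

lemma missOdds_nonneg {A : Set ℝ} (hAI : A ⊆ trackInterval) (hpos : 0 < volume.real A) :
    0 ≤ missOdds A := by
  have : volume.real A ≤ 1 / 2 := by
    rw [← volumeReal_trackInterval]
    exact measureReal_mono hAI (volume_ne_top_of_subset_trackInterval subset_rfl)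
  rw [missOdds, sub_nonneg, le_div_iff₀ hpos]; linarith

/-- One more random summand shrinks the expected odds by a constant factor. -/
lemma lintegral_missOdds_union_newPoints_le {ν : Measure ℝ} [IsProbabilityMeasure ν]
    (hν : DominatesLebesgue ν) {A : Set ℝ} (hA : MeasurableSet A) (hAI : A ⊆ trackInterval)
    (hpos : 0 < volume.real A) :
    ∫⁻ x, ENNReal.ofReal (missOdds (A ∪ newPoints A x)) ∂ν
      ≤ ENNReal.ofReal (31 / 32) * ENNReal.ofReal (missOdds A) := by
  set v := volume.real A with hv
  have hAt := volume_ne_top_of_subset_trackInterval hAI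
  set g : ℝ → ℝ := fun x => volume.real (newPoints A x) with hg
  have hnt : ∀ x, volume (newPoints A x) ≠ ⊤ := fun x =>
    volume_ne_top_of_subset_trackInterval fun y hy => hy.1.1
  have hg0 : ∀ x, 0 ≤ g x := fun x => measureReal_nonneg
  have hgv : ∀ x, g x ≤ v := fun x => ENNReal.toReal_mono hAt (volume_newPoints_le hA x)
  have hgm : Measurable g :=
    (measurable_measure_prodMk_left (measurableSet_prod_newPoints hA)).ennreal_toReal
  have hgi : Integrable g ν := by
    refine Integrable.of_bound hgm.aestronglyMeasurable v (ae_of_all _ fun x => ?_)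
    rw [Real.norm_of_nonneg (hg0 x)]; exact hgv x
  have hdiff : volume.real (trackInterval \ A) = 1 / 2 - v := by
    rw [measureReal_sdiff hAI hA (volume_ne_top_of_subset_trackInterval subset_rfl),
      volumeReal_trackInterval]
  have hgain : v * (1 / 2 - v) ≤ 8 * ∫ x, g x ∂ν := by
    have h := volume_mul_volume_diff_le hν hA hAI
    have h2 : ∫⁻ x, volume (newPoints A x) ∂ν = ENNReal.ofReal (∫ x, g x ∂ν) := by
      rw [ofReal_integral_eq_lintegral_ofReal hgi (ae_of_all _ hg0)]
      exact lintegral_congr fun x => (ENNReal.ofReal_toReal (hnt x)).symm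
    rw [h2] at h
    have h3 := ENNReal.toReal_mono (by finiteness) h
    rw [ENNReal.toReal_mul, ENNReal.toReal_mul,
      ENNReal.toReal_ofReal (integral_nonneg hg0)] at h3
    rw [← hdiff]
    simpa [Measure.real, hv] using h3
  have hw : ∀ x, missOdds (A ∪ newPoints A x) ≤ missOdds A - 1 / 2 * (g x / (2 * v ^ 2)) := by
    intro x
    have hu : volume.real (A ∪ newPoints A x) = v + g x :=
      measureReal_union (Set.disjoint_left.2 fun y hy hy' => hy'.1.2 hy)
        (measurableSet_newPoints hA x) hAt (hnt x)
    rw [missOdds, missOdds, hu, ← hv]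
    have h0 := hg0 x
    have h1 := hgv x
    -- The decrease of `1 / v` is `g / (v (v + g))`, and `g ≤ v` bounds the denominator by `2 v ^
    -- 2`. This makes the estimate linear in `g`, so that only its mean matters.
    have key : 1 / (v + g x) ≤ 1 / v - g x / (2 * v ^ 2) := by
      rw [div_sub_div _ _ hpos.ne' (by positivity), div_le_div_iff₀ (by positivity) (by positivity)]
      nlinarith [mul_nonneg (mul_nonneg hpos.le h0) (sub_nonneg.2 h1)]
    have e1 : 1 / 2 / (v + g x) = 1 / 2 * (1 / (v + g x)) := by ring
    have e2 : 1 / 2 / v = 1 / 2 * (1 / v) := by ring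
    rw [e1, e2]; linarith
  have hint : Integrable (fun x => missOdds A - 1 / 2 * (g x / (2 * v ^ 2))) ν :=
    (integrable_const _).sub ((hgi.div_const _).const_mul _)
  have hnn : ∀ x, 0 ≤ missOdds A - 1 / 2 * (g x / (2 * v ^ 2)) := fun x =>
    (missOdds_nonneg (Set.union_subset hAI fun y hy => hy.1.1)
      (hpos.trans_le (measureReal_mono Set.subset_union_left
        (measure_union_ne_top hAt (hnt x))))).trans (hw x)
  calc ∫⁻ x, ENNReal.ofReal (missOdds (A ∪ newPoints A x)) ∂ν
      ≤ ∫⁻ x, ENNReal.ofReal (missOdds A - 1 / 2 * (g x / (2 * v ^ 2))) ∂ν :=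
        lintegral_mono fun x => ENNReal.ofReal_le_ofReal (hw x)
    _ = ENNReal.ofReal (∫ x, missOdds A - 1 / 2 * (g x / (2 * v ^ 2)) ∂ν) :=
        (ofReal_integral_eq_lintegral_ofReal hint (ae_of_all _ hnn)).symm
    _ ≤ ENNReal.ofReal (31 / 32 * missOdds A) := by
        refine ENNReal.ofReal_le_ofReal ?_
        rw [integral_sub (integrable_const _) ((hgi.div_const _).const_mul _), integral_const_mul,
          integral_div]
        simp only [integral_const, probReal_univ, one_smul]
        have h4 : v * (1 / 2 - v) / 8 / (2 * v ^ 2) ≤ (∫ x, g x ∂ν) / (2 * v ^ 2) := by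
          gcongr; linarith
        -- The reason for tracking odds: the guaranteed mean decrease is itself a multiple of the
        -- odds, so the recursion is linear.
        have h5 : v * (1 / 2 - v) / 8 / (2 * v ^ 2) = 1 / 16 * missOdds A := by
          rw [missOdds, ← hv]; field_simp; ring
        linarith
    _ = _ := ENNReal.ofReal_mul (by norm_num)

lemma half_le_log {L : ℝ} (hL : 2 ≤ L) : 1 / 2 ≤ Real.log L :=
  (by linarith [Real.log_two_gt_d9] : (1 : ℝ) / 2 ≤ Real.log 2).trans
    (Real.log_le_log (by norm_num) hL)

/-! ### Random subset sums -/

section SubsetSum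

variable {ι : Type*}

/-- Points of the tracking interval that are `δ`-close to a subset sum of `x` over `l`, all of whose
partial sums stay within the tracking interval up to `δ`. -/
def reach (δ : ℝ) : List ι → (ι → ℝ) → Set ℝ
  | [], _ => Set.Icc (-δ) δ
  | a :: l, x => reach δ l x ∪ newPoints (reach δ l x) (x a)

lemma reach_congr (δ : ℝ) {l : List ι} {x x' : ι → ℝ} (h : ∀ i ∈ l, x i = x' i) :
    reach δ l x = reach δ l x' := by
  induction l with
  | nil => rfl
  | cons a l ih =>
    rw [reach, reach, ih fun i hi => h i (List.mem_cons_of_mem a hi), h a List.mem_cons_self]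

lemma Icc_subset_reach (δ : ℝ) (l : List ι) (x : ι → ℝ) : Set.Icc (-δ) δ ⊆ reach δ l x := by
  induction l with
  | nil => exact subset_rfl
  | cons a l ih => exact ih.trans Set.subset_union_left

lemma reach_subset_trackInterval {δ : ℝ} (hδ : δ ≤ 1 / 4) (l : List ι) (x : ι → ℝ) :
    reach δ l x ⊆ trackInterval := by
  induction l with
  | nil => exact Set.Icc_subset_Icc (by linarith) hδ
  | cons a l ih => exact Set.union_subset ih fun y hy => hy.1.1

lemma exists_subsetSum_of_mem_reach [DecidableEq ι] {δ : ℝ} {l : List ι} (hl : l.Nodup)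
    {x : ι → ℝ} {y : ℝ} (hy : y ∈ reach δ l x) :
    ∃ S ⊆ l.toFinset, |y - ∑ i ∈ S, x i| ≤ δ := by
  induction l generalizing y with
  | nil => exact ⟨∅, by simp, by simpa using abs_le.2 hy⟩
  | cons a l ih =>
    rw [List.nodup_cons] at hl
    rcases hy with hy | hy
    · obtain ⟨S, hS, h⟩ := ih hl.2 hy
      exact ⟨S, hS.trans (by simp [Finset.subset_insert]), h⟩
    · obtain ⟨S, hS, h⟩ := ih hl.2 hy.2
      have ha : a ∉ S := fun h => hl.1 (List.mem_toFinset.1 (hS h))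
      refine ⟨insert a S, ?_, ?_⟩
      · rw [List.toFinset_cons]; exact Finset.insert_subset_insert a hS
      · rwa [Finset.sum_insert ha, ← sub_sub]

lemma measurableSet_reach_prod (δ : ℝ) (l : List ι) :
    MeasurableSet {p : (ι → ℝ) × ℝ | p.2 ∈ reach δ l p.1} := by
  induction l with
  | nil => exact measurable_snd measurableSet_Icc
  | cons a l ih =>
    have h2 : Measurable fun p : (ι → ℝ) × ℝ => (p.1, p.2 - p.1 a) := by fun_prop
    exact ih.union (((measurable_snd measurableSet_trackInterval).diff ih).inter (h2 ih))

lemma measurableSet_reach (δ : ℝ) (l : List ι) (x : ι → ℝ) : MeasurableSet (reach δ l x) :=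
  measurable_prodMk_left (measurableSet_reach_prod δ l)

lemma measurable_missOdds {β : Type*} [MeasurableSpace β] {R : Set (β × ℝ)}
    (hR : MeasurableSet R) : Measurable fun b => missOdds (Prod.mk b ⁻¹' R) :=
  ((measurable_measure_prodMk_left hR).ennreal_toReal.const_div _).sub_const _

lemma measurable_missOdds_reach (δ : ℝ) (l : List ι) :
    Measurable fun x : ι → ℝ => missOdds (reach δ l x) :=
  measurable_missOdds (measurableSet_reach_prod δ l)

lemma measurable_missOdds_reach_union_newPoints (δ : ℝ) (l : List ι) :
    Measurable fun p : (ι → ℝ) × ℝ =>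
      missOdds (reach δ l p.1 ∪ newPoints (reach δ l p.1) p.2) := by
  have hR := measurableSet_reach_prod δ l
  have h1 : Measurable fun q : ((ι → ℝ) × ℝ) × ℝ => (q.1.1, q.2) := by fun_prop
  have h2 : Measurable fun q : ((ι → ℝ) × ℝ) × ℝ => (q.1.1, q.2 - q.1.2) := by fun_prop
  exact measurable_missOdds ((h1 hR).union
    (((measurable_snd measurableSet_trackInterval).diff (h1 hR)).inter (h2 hR)))

lemma volumeReal_reach_pos {δ : ℝ} (hδ : 0 < δ) (hδ' : δ ≤ 1 / 4) (l : List ι) (x : ι → ℝ) :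
    0 < volume.real (reach δ l x) := by
  have h := measureReal_mono (Icc_subset_reach δ l x)
    (volume_ne_top_of_subset_trackInterval (reach_subset_trackInterval hδ' l x))
  rw [Real.volume_real_Icc_of_le (by linarith)] at h
  linarith

variable {Ω : Type*} [MeasurableSpace Ω] {μ : Measure Ω} [IsProbabilityMeasure μ] [DecidableEq ι]

/-- Every variable of the family is independent of any finite collection of the others. -/
def IndepOfOthers (μ : Measure Ω) (X : ι → Ω → ℝ) : Prop :=
  ∀ (l : List ι) (a : ι), a ∉ l → IndepFun (fun ω i => if i ∈ l then X i ω else 0) (X a) μ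

/-- Induction on the list: by independence the new summand can be integrated first, with the old
ones frozen. The initial interval `[-δ, δ]` has odds below `1 / (4 * δ)`. -/
lemma lintegral_missOdds_reach_le [Finite ι] {X : ι → Ω → ℝ} (hX : ∀ i, AEMeasurable (X i) μ)
    (hind : IndepOfOthers μ X) (hdom : ∀ i, DominatesLebesgue (μ.map (X i)))
    {δ : ℝ} (hδ : 0 < δ) (hδ' : δ ≤ 1 / 4) {l : List ι} (hl : l.Nodup) :
    ∫⁻ ω, ENNReal.ofReal (missOdds (reach δ l fun i => X i ω)) ∂μ
      ≤ ENNReal.ofReal (31 / 32) ^ l.length * ENNReal.ofReal (1 / (4 * δ)) := by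
  induction l with
  | nil =>
    simp only [reach, lintegral_const, measure_univ, mul_one, List.length_nil, pow_zero, one_mul]
    refine ENNReal.ofReal_le_ofReal ?_
    rw [missOdds, Real.volume_real_Icc_of_le (by linarith)]
    have : 1 / 2 / (δ - -δ) = 1 / (4 * δ) := by field_simp; ring
    linarith
  | cons a l ih =>
    rw [List.nodup_cons] at hl
    -- Coordinates outside `l` are zeroed to match `IndepOfOthers`; `reach` over `l` does not see
    -- them.
    set Y : Ω → ι → ℝ := fun ω i => if i ∈ l then X i ω else 0 with hY
    have hYm : AEMeasurable Y μ := by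
      refine aemeasurable_pi_lambda _ fun i => ?_
      by_cases h : i ∈ l
      · simpa [hY, h] using hX i
      · simp [hY, h]
    have hYX : ∀ ω, reach δ l (fun i => X i ω) = reach δ l (Y ω) := fun ω =>
      reach_congr δ fun i hi => by simp [hY, hi]
    set F : (ι → ℝ) × ℝ → ENNReal := fun p =>
      ENNReal.ofReal (missOdds (reach δ l p.1 ∪ newPoints (reach δ l p.1) p.2)) with hF
    have hFm : Measurable F := (measurable_missOdds_reach_union_newPoints δ l).ennreal_ofReal
    have : IsProbabilityMeasure (μ.map (X a)) := Measure.isProbabilityMeasure_map (hX a)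
    have : IsProbabilityMeasure (μ.map Y) := Measure.isProbabilityMeasure_map hYm
    calc ∫⁻ ω, ENNReal.ofReal (missOdds (reach δ (a :: l) fun i => X i ω)) ∂μ
        = ∫⁻ ω, F (Y ω, X a ω) ∂μ := by
          refine lintegral_congr fun ω => ?_
          rw [reach, hYX]
      _ = ∫⁻ x, ∫⁻ t, F (x, t) ∂(μ.map (X a)) ∂(μ.map Y) := by
          rw [← lintegral_prod _ hFm.aemeasurable,
            ← (hind l a hl.1).map_prod_eq_prod_map_map hYm (hX a),
            lintegral_map' hFm.aemeasurable (hYm.prodMk (hX a))]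
      _ ≤ ∫⁻ x, ENNReal.ofReal (31 / 32) * ENNReal.ofReal (missOdds (reach δ l x)) ∂(μ.map Y) := by
          refine lintegral_mono fun x => ?_
          have h := lintegral_missOdds_union_newPoints_le (hdom a)
            (measurableSet_reach δ l x) (reach_subset_trackInterval hδ' l x)
            (volumeReal_reach_pos hδ hδ' l x)
          simpa only [hF] using h
      _ = ENNReal.ofReal (31 / 32) *
            ∫⁻ ω, ENNReal.ofReal (missOdds (reach δ l fun i => X i ω)) ∂μ := by
          have hm := (measurable_missOdds_reach (ι := ι) δ l).ennreal_ofReal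
          rw [lintegral_const_mul _ hm, lintegral_map' hm.aemeasurable hYm]
          simp only [hYX]
      _ ≤ _ := by
          rw [List.length_cons, pow_succ', mul_assoc]
          gcongr
          exact ih hl.2

/-- Odds below `δ` leave less than `δ` of the tracking interval uncovered, so no subinterval of
length `δ` is missed. One `δ` is lost in moving from `z` to a reached point, another from there to a
subset sum. -/
lemma exists_subsetSum_of_missOdds_lt {δ : ℝ} (hδ : 0 < δ) (hδ' : δ ≤ 1 / 4) {l : List ι}
    (hl : l.Nodup) {x : ι → ℝ} (hx : missOdds (reach δ l x) < δ) {z : ℝ} (hz : z ∈ trackInterval) :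
    ∃ S ⊆ l.toFinset, |∑ i ∈ S, x i - z| ≤ 2 * δ := by
  set A := reach δ l x with hA
  have hAI : A ⊆ trackInterval := reach_subset_trackInterval hδ' l x
  have hIt := volume_ne_top_of_subset_trackInterval subset_rfl
  have hpos : 0 < volume.real A := volumeReal_reach_pos hδ hδ' l x
  have hgap : volume.real (trackInterval \ A) < δ := by
    rw [measureReal_sdiff hAI (measurableSet_reach δ l x) hIt, volumeReal_trackInterval]
    rw [missOdds, sub_lt_iff_lt_add, div_lt_iff₀ hpos] at hx
    have h1 : volume.real A ≤ 1 / 2 := by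
      rw [← volumeReal_trackInterval]; exact measureReal_mono hAI hIt
    nlinarith
  have hne : ∃ y ∈ A, |y - z| ≤ δ := by
    by_contra! hno
    -- The subinterval extends from `z` towards the centre, so it does not leave the tracking
    -- interval.
    obtain ⟨a, ha⟩ : ∃ a, Set.Icc a (a + δ) ⊆ trackInterval ∧
        Set.Icc a (a + δ) ⊆ Set.Icc (z - δ) (z + δ) := by
      simp only [trackInterval, Set.mem_Icc] at hz
      rcases le_total z 0 with h | h
      · exact ⟨z, Set.Icc_subset_Icc (by linarith) (by linarith),
          Set.Icc_subset_Icc (by linarith) (by linarith)⟩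
      · exact ⟨z - δ, Set.Icc_subset_Icc (by linarith) (by linarith),
          Set.Icc_subset_Icc (by linarith) (by linarith)⟩
    have hsub : Set.Icc a (a + δ) ⊆ trackInterval \ A := fun y hy => by
      refine ⟨ha.1 hy, fun hyA => absurd (hno y hyA) (not_lt.2 ?_)⟩
      have := ha.2 hy
      rw [abs_le]; constructor <;> linarith [this.1, this.2]
    have := measureReal_mono hsub (volume_ne_top_of_subset_trackInterval Set.sdiff_subset)
    rw [Real.volume_real_Icc_of_le (by linarith)] at this
    linarith
  obtain ⟨y, hyA, hyz⟩ := hne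
  obtain ⟨S, hS, hyS⟩ := exists_subsetSum_of_mem_reach hl hyA
  refine ⟨S, hS, ?_⟩
  rw [abs_le] at *
  constructor <;> linarith [hyz.1, hyz.2, hyS.1, hyS.2]

/-- Markov's inequality for the odds at level `δ`. -/
lemma measure_no_subsetSum_le_of_mem_trackInterval [Finite ι] {X : ι → Ω → ℝ}
    (hX : ∀ i, AEMeasurable (X i) μ)
    (hind : IndepOfOthers μ X) (hdom : ∀ i, DominatesLebesgue (μ.map (X i)))
    {δ : ℝ} (hδ : 0 < δ) (hδ' : δ ≤ 1 / 4) (s : Finset ι) {z : ℝ} (hz : z ∈ trackInterval) :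
    μ {ω | ∀ S ⊆ s, 2 * δ < |∑ i ∈ S, X i ω - z|}
      ≤ ENNReal.ofReal ((31 / 32) ^ s.card / (4 * δ ^ 2)) := by
  have hm : AEMeasurable
      (fun ω => ENNReal.ofReal (missOdds (reach δ s.toList fun i => X i ω))) μ :=
    ((measurable_missOdds_reach (ι := ι) δ s.toList).comp_aemeasurable
      (aemeasurable_pi_lambda _ hX)).ennreal_ofReal
  have hmk := mul_meas_ge_le_lintegral₀ hm (ENNReal.ofReal δ)
  have hle := hmk.trans
    (lintegral_missOdds_reach_le hX hind hdom hδ hδ' s.nodup_toList)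
  have hsub : {ω | ∀ S ⊆ s, 2 * δ < |∑ i ∈ S, X i ω - z|} ⊆
      {ω | ENNReal.ofReal δ ≤ ENNReal.ofReal (missOdds (reach δ s.toList fun i => X i ω))} := by
    intro ω hω
    refine ENNReal.ofReal_le_ofReal (not_lt.1 fun hlt => ?_)
    obtain ⟨S, hS, h⟩ := exists_subsetSum_of_missOdds_lt hδ hδ' s.nodup_toList hlt hz
    rw [Finset.toList_toFinset] at hS
    exact absurd (hω S hS) (not_lt.2 h)
  refine (measure_mono hsub).trans ?_
  have h0 : ENNReal.ofReal δ ≠ 0 := by simpa using hδ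
  rw [mul_comm, ← ENNReal.le_div_iff_mul_le (Or.inl h0) (Or.inl ENNReal.ofReal_ne_top)] at hle
  refine hle.trans (le_of_eq ?_)
  rw [← ENNReal.ofReal_pow (by norm_num), ← ENNReal.ofReal_mul (by positivity),
    ← ENNReal.ofReal_div_of_pos hδ, Finset.length_toList]
  congr 1; field_simp

/-- A fixed `z ∈ [-1, 1]` is approximated by a subset sum of logarithmically many random summands. -/
lemma measure_no_subsetSum_le [Finite ι] {X : ι → Ω → ℝ} (hX : ∀ i, AEMeasurable (X i) μ)
    (hind : IndepOfOthers μ X) (hdom : ∀ i, DominatesLebesgue (μ.map (X i)))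
    {L : ℝ} (hL : 2 ≤ L) {s : Finset ι} (hs : 1160 * Real.log L ≤ s.card) {z : ℝ} (hz : |z| ≤ 1) :
    μ {ω | ∀ S ⊆ s, 1 / L < |∑ i ∈ S, X i ω - z|} ≤ ENNReal.ofReal (1 / L) := by
  have hlog := half_le_log hL
  set n := ⌈288 * Real.log L⌉₊ with hn
  have hn1 : 288 * Real.log L ≤ n := Nat.le_ceil _
  have hn2 : (n : ℝ) < 288 * Real.log L + 1 := Nat.ceil_lt_add_one (by positivity)
  have hcard : 4 * n ≤ s.card := by
    have : (4 * n : ℝ) ≤ s.card := by linarith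
    exact_mod_cast this
  -- Four disjoint blocks each approximate `z / 4`, which lies in the tracking interval, within `2 *
  -- δ = 1 / (4 * L)`.
  obtain ⟨B, hBs, hBc, hBd⟩ : ∃ B : Fin 4 → Finset ι, (∀ q, B q ⊆ s) ∧ (∀ q, (B q).card = n) ∧
      Pairwise (Function.onFun Disjoint B) := by
    have e : (Fin 4 × Fin n) ↪ s := by
      refine (Function.Embedding.nonempty_of_card_le ?_).some
      simpa using hcard
    refine ⟨fun q => Finset.univ.image fun t => (e (q, t) : ι), fun q i hi => ?_, fun q => ?_,
      fun q q' hq => ?_⟩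
    · obtain ⟨t, -, rfl⟩ := Finset.mem_image.1 hi
      exact (e (q, t)).2
    · rw [Finset.card_image_of_injective, Finset.card_univ, Fintype.card_fin]
      intro t t' h
      exact (Prod.ext_iff.1 (e.injective (Subtype.ext h))).2
    · refine Finset.disjoint_left.2 fun i hi hi' => ?_
      obtain ⟨t, -, rfl⟩ := Finset.mem_image.1 hi
      obtain ⟨t', -, h⟩ := Finset.mem_image.1 hi'
      exact hq (Prod.ext_iff.1 (e.injective (Subtype.ext h))).1.symm
  have hz4 : z / 4 ∈ trackInterval := by
    rw [abs_le] at hz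
    constructor <;> linarith [hz.1, hz.2]
  set δ := 1 / (8 * L) with hδd
  have hδ : 0 < δ := by positivity
  have hδ' : δ ≤ 1 / 4 := by
    rw [hδd]; exact one_div_le_one_div_of_le (by norm_num) (by linarith)
  have hsub : {ω | ∀ S ⊆ s, 1 / L < |∑ i ∈ S, X i ω - z|} ⊆
      ⋃ q : Fin 4, {ω | ∀ S ⊆ B q, 2 * δ < |∑ i ∈ S, X i ω - z / 4|} := by
    intro ω hω
    by_contra hno
    simp only [Set.mem_iUnion, Set.mem_ofPred_eq, not_exists, not_forall, not_lt] at hno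
    choose S hS hSz using hno
    refine absurd (hω (Finset.univ.biUnion S)
      (Finset.biUnion_subset.2 fun q _ => (hS q).trans (hBs q))) (not_lt.2 ?_)
    rw [Finset.sum_biUnion fun q _ q' _ hq => (hBd hq).mono (hS q) (hS q')]
    have h1 : ∑ q, ∑ i ∈ S q, X i ω - z = ∑ q : Fin 4, (∑ i ∈ S q, X i ω - z / 4) := by
      simp [Finset.sum_sub_distrib]; ring
    rw [h1]
    refine (Finset.abs_sum_le_sum_abs _ _).trans ((Finset.sum_le_sum fun q _ => hSz q).trans ?_)
    simp only [Finset.sum_const, Finset.card_univ, Fintype.card_fin, nsmul_eq_mul, hδd]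
    have hL0 : L ≠ 0 := by linarith
    refine le_of_eq ?_
    push_cast
    field_simp; norm_num
  refine (measure_mono hsub).trans ((measure_iUnion_fintype_le _ _).trans ?_)
  refine (Finset.sum_le_sum fun q _ =>
    measure_no_subsetSum_le_of_mem_trackInterval hX hind hdom hδ hδ' (B q) hz4).trans ?_
  simp only [hBc, Finset.sum_const, Finset.card_univ, Fintype.card_fin]
  rw [← ENNReal.ofReal_nsmul]
  refine ENNReal.ofReal_le_ofReal ?_
  have hL0 : 0 < L := by linarith
  -- Since `288 / 32 = 9`, the decay is `L ^ (-9)`; it pays for `L ^ 2` from `δ`, for the factor `64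
  -- ≤ L ^ 6`, and leaves `1 / L`.
  have hpow : (31 / 32 : ℝ) ^ n ≤ 1 / L ^ 9 := by
    have h1 : (31 / 32 : ℝ) ≤ Real.exp (-(1 / 32)) := by
      linarith [Real.add_one_le_exp (-(1 / 32) : ℝ)]
    calc (31 / 32 : ℝ) ^ n ≤ Real.exp (-(1 / 32)) ^ n := by gcongr
      _ = Real.exp (n * (-(1 / 32))) := (Real.exp_nat_mul _ _).symm
      _ ≤ Real.exp (-(9 * Real.log L)) := Real.exp_le_exp.2 (by linarith)
      _ = 1 / L ^ 9 := by
        rw [Real.exp_neg, mul_comm, Real.exp_mul, Real.exp_log hL0, one_div]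
        norm_cast
  have h64 : (64 : ℝ) ≤ L ^ 6 := by
    calc (64 : ℝ) = 2 ^ 6 := by norm_num
      _ ≤ L ^ 6 := by gcongr
  calc 4 • ((31 / 32) ^ n / (4 * δ ^ 2)) = (31 / 32) ^ n * (64 * L ^ 2) := by
        rw [hδd, nsmul_eq_mul]; push_cast; field_simp; norm_num
    _ ≤ 1 / L ^ 9 * (L ^ 6 * L ^ 2) := by gcongr
    _ = 1 / L := by field_simp

end SubsetSum

/-! ### Products of independent uniform variables -/

section UniformProducts

variable {Ω : Type*} [MeasurableSpace Ω] {μ : Measure Ω}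

lemma aemeasurable_of_isUniform_Icc {u : Ω → ℝ} {a : ℝ} (ha : 0 < a)
    (hu : pdf.IsUniform u (Set.Icc (-a) a) μ volume) : AEMeasurable u μ :=
  hu.aemeasurable (by rw [Real.volume_Icc]; simp; linarith) (by rw [Real.volume_Icc]; simp)

/-- The normalized product of two independent uniform variables has a density that is bounded below
near zero. -/
lemma dominatesLebesgue_map_mul [IsProbabilityMeasure μ] {u w : Ω → ℝ} {a : ℝ} (ha : 0 < a)
    (hu : pdf.IsUniform u (Set.Icc (-a) a) μ volume)
    (hw : pdf.IsUniform w (Set.Icc (-a) a) μ volume) (huw : IndepFun u w μ) :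
    DominatesLebesgue (μ.map fun ω => (a ^ 2)⁻¹ * (u ω * w ω)) := by
  intro B hB hBI
  have hum := aemeasurable_of_isUniform_Icc ha hu
  have hwm := aemeasurable_of_isUniform_Icc ha hw
  set U := ProbabilityTheory.cond volume (Set.Icc (-a) a) with hU
  have hUu : μ.map u = U := hu
  have hUw : μ.map w = U := hw
  have : IsProbabilityMeasure U := hUu ▸ Measure.isProbabilityMeasure_map hum
  set φ : ℝ × ℝ → ℝ := fun p => (a ^ 2)⁻¹ * (p.1 * p.2) with hφ
  have hφm : Measurable φ := by fun_prop
  have hlaw : (μ.map fun ω => (a ^ 2)⁻¹ * (u ω * w ω)) B =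
      ∫⁻ t, U ((fun s => φ (s, t)) ⁻¹' B) ∂U := by
    have h1 : (fun ω => (a ^ 2)⁻¹ * (u ω * w ω)) = φ ∘ fun ω => (u ω, w ω) := rfl
    rw [h1, ← AEMeasurable.map_map_of_aemeasurable hφm.aemeasurable (hum.prodMk hwm),
      huw.map_prod_eq_prod_map_map hum hwm, hUu, hUw, Measure.map_apply hφm hB,
      Measure.prod_apply_symm (hφm hB)]
    rfl
  have hvol : volume (Set.Icc (-a) a) = ENNReal.ofReal (2 * a) := by
    rw [Real.volume_Icc]; congr 1; ring
  -- With the second factor fixed at `t ∈ [a/2, a]`, the normalized product is uniform on an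
  -- interval containing `[-1/2, 1/2]`, with density at least `1/2`. Such `t` have probability
  -- `1/4`, whence the constant `8`.
  have hsec : ∀ t ∈ Set.Icc (a / 2) a,
      ENNReal.ofReal (1 / 2) * volume B ≤ U ((fun s => φ (s, t)) ⁻¹' B) := by
    rintro t ⟨ht1, ht2⟩
    have ht0 : 0 < t := by linarith
    have hpre : (fun s => φ (s, t)) ⁻¹' B = (fun s => (t / a ^ 2) * s) ⁻¹' B := by
      ext s
      simp only [hφ, Set.mem_preimage]
      rw [show (a ^ 2)⁻¹ * (s * t) = t / a ^ 2 * s by field_simp]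
    have hin : (fun s => (t / a ^ 2) * s) ⁻¹' B ⊆ Set.Icc (-a) a := by
      intro s hs
      have h := hBI hs
      have hs' : s = a ^ 2 / t * (t / a ^ 2 * s) := by field_simp
      have hr : a ^ 2 / t ≤ 2 * a := by
        rw [div_le_iff₀ ht0]; nlinarith
      have hr0 : 0 < a ^ 2 / t := by positivity
      rw [Set.mem_Icc, ← abs_le] at h
      rw [Set.mem_Icc, ← abs_le, hs', abs_mul, abs_of_pos hr0]
      nlinarith [abs_nonneg (t / a ^ 2 * s)]
    rw [hU, cond_apply measurableSet_Icc, hpre, Set.inter_eq_self_of_subset_right hin,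
      Real.volume_preimage_mul_left (by positivity), hvol, ← mul_assoc]
    gcongr
    rw [← ENNReal.ofReal_inv_of_pos (by positivity), ← ENNReal.ofReal_mul (by positivity)]
    refine ENNReal.ofReal_le_ofReal ?_
    rw [abs_of_pos (by positivity), inv_div]
    have : (2 * a)⁻¹ * (a ^ 2 / t) = a / (2 * t) := by field_simp
    rw [this, div_le_div_iff₀ (by norm_num) (by positivity)]
    linarith
  have hquarter : U (Set.Icc (a / 2) a) = ENNReal.ofReal (1 / 4) := by
    rw [hU, cond_apply measurableSet_Icc, Set.inter_eq_self_of_subset_right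
      (Set.Icc_subset_Icc (by linarith) le_rfl), hvol, Real.volume_Icc,
      ← ENNReal.ofReal_inv_of_pos (by positivity), ← ENNReal.ofReal_mul (by positivity)]
    congr 1; field_simp; norm_num
  have hmain : ENNReal.ofReal (1 / 2) * volume B * ENNReal.ofReal (1 / 4)
      ≤ (μ.map fun ω => (a ^ 2)⁻¹ * (u ω * w ω)) B := by
    rw [hlaw, ← hquarter]
    calc ENNReal.ofReal (1 / 2) * volume B * U (Set.Icc (a / 2) a)
        = ∫⁻ _ in Set.Icc (a / 2) a, ENNReal.ofReal (1 / 2) * volume B ∂U := by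
          rw [lintegral_const, Measure.restrict_apply_univ]
      _ ≤ ∫⁻ t in Set.Icc (a / 2) a, U ((fun s => φ (s, t)) ⁻¹' B) ∂U :=
          setLIntegral_mono' measurableSet_Icc hsec
      _ ≤ _ := setLIntegral_le_lintegral _ _
  calc volume B = 8 * (ENNReal.ofReal (1 / 2) * volume B * ENNReal.ofReal (1 / 4)) := by
        have : (8 : ENNReal) = ENNReal.ofReal 8 := by norm_num
        rw [this, mul_right_comm, ← ENNReal.ofReal_mul (by norm_num), ← mul_assoc,
          ← ENNReal.ofReal_mul (by norm_num)]
        norm_num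
    _ ≤ _ := by gcongr

/-- The products over `l` and the product at `a` are functions of disjoint sets of coordinates of
the independent family. -/
lemma indepOfOthers_mul {E ι : Type*} [DecidableEq ι] {f : E → Ω → ℝ}
    (hf : iIndepFun f μ) (hfm : ∀ e, AEMeasurable (f e) μ) {p q : ι → E}
    (hpp : p.Injective) (hqq : q.Injective) (hpq : ∀ i j, p i ≠ q j) (c : ℝ) :
    IndepOfOthers μ fun i ω => c * (f (p i) ω * f (q i) ω) := by
  classical
  intro l a ha
  set S : Finset E := l.toFinset.image p ∪ l.toFinset.image q with hS
  set T : Finset E := {p a, q a} with hT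
  have hST : Disjoint S T := by
    have h1 : ∀ i ∈ l, i ≠ a := fun i hi h => ha (h ▸ hi)
    rw [Finset.disjoint_left]
    intro e he heT
    simp only [hS, hT, Finset.mem_union, Finset.mem_image, List.mem_toFinset, Finset.mem_insert,
      Finset.mem_singleton] at he heT
    rcases he with ⟨i, hi, rfl⟩ | ⟨i, hi, rfl⟩ <;> rcases heT with h | h
    · exact h1 i hi (hpp h)
    · exact hpq _ _ h
    · exact hpq _ _ h.symm
    · exact h1 i hi (hqq h)
  have hind := hf.indepFun_finset₀ S T hST hfm
  have hpS : ∀ i ∈ l, p i ∈ S := fun i hi =>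
    Finset.mem_union_left _ (Finset.mem_image_of_mem p (List.mem_toFinset.2 hi))
  have hqS : ∀ i ∈ l, q i ∈ S := fun i hi =>
    Finset.mem_union_right _ (Finset.mem_image_of_mem q (List.mem_toFinset.2 hi))
  let Φ : (S → ℝ) → ι → ℝ := fun x i =>
    if h : i ∈ l then c * (x ⟨p i, hpS i h⟩ * x ⟨q i, hqS i h⟩) else 0
  let Ψ : (T → ℝ) → ℝ := fun x => c * (x ⟨p a, by simp [hT]⟩ * x ⟨q a, by simp [hT]⟩)
  have hΦ : Measurable Φ := by
    refine measurable_pi_lambda _ fun i => ?_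
    by_cases h : i ∈ l
    · simp only [Φ, h, dite_true]; fun_prop
    · simp only [Φ, h, dite_false]; fun_prop
  have hΨ : Measurable Ψ := by fun_prop
  have h := hind.comp hΦ hΨ
  convert h using 1
  · funext ω i
    simp only [Φ, Function.comp]
    split_ifs <;> rfl
  · rfl

/-- A fixed number is approximated by a pruned inner product of two uniform random vectors. -/
lemma measure_no_subsetSum_mul_le [IsProbabilityMeasure μ] {E ι : Type*} [DecidableEq ι]
    [Finite ι] {f : E → Ω → ℝ}
    (hf : iIndepFun f μ) (hfm : ∀ e, AEMeasurable (f e) μ) {p q : ι → E}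
    (hpp : p.Injective) (hqq : q.Injective) (hpq : ∀ i j, p i ≠ q j) {a : ℝ} (ha : 0 < a)
    (hp : ∀ i, pdf.IsUniform (f (p i)) (Set.Icc (-a) a) μ volume)
    (hq : ∀ i, pdf.IsUniform (f (q i)) (Set.Icc (-a) a) μ volume)
    {L : ℝ} (hL : 2 ≤ L) {s : Finset ι} (hs : 1160 * Real.log L ≤ s.card) {z : ℝ} (hz : |z| ≤ 1) :
    μ {ω | ∀ S ⊆ s, 1 / L < |(a ^ 2)⁻¹ * ∑ i ∈ S, f (p i) ω * f (q i) ω - z|}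
      ≤ ENNReal.ofReal (1 / L) := by
  simp only [Finset.mul_sum]
  exact measure_no_subsetSum_le (X := fun i ω => (a ^ 2)⁻¹ * (f (p i) ω * f (q i) ω))
    (fun i => ((hfm _).mul (hfm _)).const_mul _)
    (indepOfOthers_mul hf hfm hpp hqq hpq _)
    (fun i => dominatesLebesgue_map_mul ha (hp i) (hq i) (hf.indepFun (hpq i i))) hL hs hz

end UniformProducts

/-! ### Norm bounds from entrywise bounds -/

section EntrywisePerturbation

variable {m n : ℕ}

/-- The Euclidean norm of a coordinate vector. -/
noncomputable def l2norm (y : Fin n → ℝ) : ℝ := ‖(WithLp.toLp 2 y : EuclideanSpace ℝ (Fin n))‖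

lemma l2norm_nonneg (y : Fin n → ℝ) : 0 ≤ l2norm y := norm_nonneg _

lemma l2norm_add_le (x y : Fin n → ℝ) : l2norm (x + y) ≤ l2norm x + l2norm y := by
  simpa [l2norm] using
    norm_add_le (WithLp.toLp 2 x : EuclideanSpace ℝ (Fin n)) (WithLp.toLp 2 y)

lemma l2norm_sum_le {κ : Type*} (s : Finset κ) (y : κ → Fin n → ℝ) :
    l2norm (∑ i ∈ s, y i) ≤ ∑ i ∈ s, l2norm (y i) := by
  simpa [l2norm, WithLp.toLp_sum] using
    norm_sum_le s fun i => (WithLp.toLp 2 (y i) : EuclideanSpace ℝ (Fin n))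

lemma l2norm_smul (c : ℝ) (y : Fin n → ℝ) : l2norm (c • y) = |c| * l2norm y := by
  simp [l2norm, norm_smul]

lemma abs_apply_le_l2norm (y : Fin n → ℝ) (i : Fin n) : |y i| ≤ l2norm y := by
  simpa [l2norm] using PiLp.norm_apply_le (WithLp.toLp 2 y : EuclideanSpace ℝ (Fin n)) i

lemma sum_abs_le_sqrt_mul_l2norm (y : Fin n → ℝ) : ∑ i, |y i| ≤ √n * l2norm y := by
  rw [l2norm, EuclideanSpace.norm_eq, ← Real.sqrt_mul (by positivity)]
  refine Real.le_sqrt_of_sq_le ?_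
  simpa using sq_sum_le_card_mul_sum_sq (s := Finset.univ) (f := fun i => |y i|)

lemma l2norm_le_sqrt_mul_of_abs_le {y : Fin n → ℝ} {b : ℝ} (hb : 0 ≤ b) (h : ∀ i, |y i| ≤ b) :
    l2norm y ≤ √n * b := by
  rw [l2norm, EuclideanSpace.norm_eq]
  refine Real.sqrt_le_iff.2 ⟨by positivity, ?_⟩
  rw [mul_pow, Real.sq_sqrt (by positivity)]
  calc ∑ i, ‖(WithLp.toLp 2 y : EuclideanSpace ℝ (Fin n)) i‖ ^ 2 ≤ ∑ _i : Fin n, b ^ 2 :=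
        Finset.sum_le_sum fun i _ => pow_le_pow_left₀ (norm_nonneg _) (h i) 2
    _ = n * b ^ 2 := by simp

lemma l2_opNorm_transpose (B : Matrix (Fin m) (Fin n) ℝ) : ‖Bᵀ‖ = ‖B‖ := by
  rw [← Matrix.conjTranspose_eq_transpose_of_trivial, Matrix.l2_opNorm_conjTranspose]

lemma l2norm_vecMul_le (y : Fin m → ℝ) (B : Matrix (Fin m) (Fin n) ℝ) :
    l2norm (y ᵥ* B) ≤ ‖B‖ * l2norm y := by
  rw [← Matrix.mulVec_transpose, ← l2_opNorm_transpose]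
  exact Matrix.l2_opNorm_mulVec Bᵀ (WithLp.toLp 2 y)

lemma abs_apply_le_l2_opNorm (B : Matrix (Fin m) (Fin n) ℝ) (r : Fin m) (s : Fin n) :
    |B r s| ≤ ‖B‖ := by
  have h := (abs_apply_le_l2norm _ s).trans (l2norm_vecMul_le (Pi.single r 1) B)
  simpa [l2norm] using h

lemma abs_vecMul_le {B : Matrix (Fin m) (Fin n) ℝ} {b : ℝ} (hb : 0 ≤ b)
    (h : ∀ r s, |B r s| ≤ b) (y : Fin m → ℝ) (s : Fin n) : |(y ᵥ* B) s| ≤ b * (√m * l2norm y) := by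
  calc |(y ᵥ* B) s| = |∑ r, y r * B r s| := rfl
    _ ≤ ∑ r, |y r * B r s| := Finset.abs_sum_le_sum_abs _ _
    _ ≤ ∑ r, b * |y r| := Finset.sum_le_sum fun r _ => by
        rw [abs_mul, mul_comm]; gcongr; exact h r s
    _ = b * ∑ r, |y r| := (Finset.mul_sum ..).symm
    _ ≤ _ := by gcongr; exact sum_abs_le_sqrt_mul_l2norm y

lemma l2norm_vecMul_le_of_abs_le {B : Matrix (Fin m) (Fin n) ℝ} {b : ℝ} (hb : 0 ≤ b)
    (h : ∀ r s, |B r s| ≤ b) (y : Fin m → ℝ) : l2norm (y ᵥ* B) ≤ √n * (b * (√m * l2norm y)) :=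
  l2norm_le_sqrt_mul_of_abs_le
    (mul_nonneg hb (mul_nonneg (Real.sqrt_nonneg _) (l2norm_nonneg y))) (abs_vecMul_le hb h y)

/-- Each vector passes from the `ℓ¹` to the `ℓ²` norm at cost `√m`. -/
lemma abs_vecMul_dotProduct_le {B : Matrix (Fin m) (Fin m) ℝ} {b : ℝ} (hb : 0 ≤ b)
    (h : ∀ r s, |B r s| ≤ b) (x y : Fin m → ℝ) :
    |(x ᵥ* B) ⬝ᵥ y| ≤ b * m * l2norm x * l2norm y := by
  have hx := l2norm_nonneg x
  calc |(x ᵥ* B) ⬝ᵥ y| ≤ ∑ s, |(x ᵥ* B) s * y s| := Finset.abs_sum_le_sum_abs _ _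
    _ ≤ ∑ s, b * (√m * l2norm x) * |y s| := Finset.sum_le_sum fun s _ => by
        rw [abs_mul]; gcongr; exact abs_vecMul_le hb h x s
    _ = b * (√m * l2norm x) * ∑ s, |y s| := (Finset.mul_sum ..).symm
    _ ≤ b * (√m * l2norm x) * (√m * l2norm y) := by
        gcongr; exact sum_abs_le_sqrt_mul_l2norm y
    _ = b * (√m * √m) * l2norm x * l2norm y := by ring
    _ = _ := by rw [Real.mul_self_sqrt (by positivity)]

end EntrywisePerturbation

/-! ### Stability of masked softmax -/

section Softmax

variable {T : ℕ} {a : Fin T → ℝ}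

lemma sum_mul_exp_pos (ha : ∀ l, 0 ≤ a l) (ha' : ∃ l, 0 < a l) (s : Fin T → ℝ) :
    0 < ∑ l, a l * Real.exp (s l) :=
  Finset.sum_pos' (fun l _ => mul_nonneg (ha l) (Real.exp_pos _).le)
    (ha'.imp fun _ hl => ⟨Finset.mem_univ _, mul_pos hl (Real.exp_pos _)⟩)

lemma maskedSoftmax_nonneg (ha : ∀ l, 0 ≤ a l) (s : Fin T → ℝ) (l : Fin T) :
    0 ≤ maskedSoftmax s a l :=
  div_nonneg (mul_nonneg (ha l) (Real.exp_pos _).le)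
    (Finset.sum_nonneg fun l _ => mul_nonneg (ha l) (Real.exp_pos _).le)

lemma sum_maskedSoftmax (ha : ∀ l, 0 ≤ a l) (ha' : ∃ l, 0 < a l) (s : Fin T → ℝ) :
    ∑ l, maskedSoftmax s a l = 1 := by
  simp only [maskedSoftmax]
  rw [← Finset.sum_div, div_self (sum_mul_exp_pos ha ha' s).ne']

/-- Numerator and denominator each change by a factor of at most `exp η`. -/
lemma maskedSoftmax_le_exp_mul (ha : ∀ l, 0 ≤ a l) (ha' : ∃ l, 0 < a l) {s s' : Fin T → ℝ}
    {η : ℝ} (h : ∀ l, |s' l - s l| ≤ η) (l : Fin T) :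
    maskedSoftmax s' a l ≤ Real.exp (2 * η) * maskedSoftmax s a l := by
  have hZ := sum_mul_exp_pos ha ha' s
  have hZ' := sum_mul_exp_pos ha ha' s'
  have h1 : a l * Real.exp (s' l) ≤ Real.exp η * (a l * Real.exp (s l)) := by
    have : Real.exp (s' l) ≤ Real.exp η * Real.exp (s l) := by
      rw [← Real.exp_add]; exact Real.exp_le_exp.2 (by linarith [(abs_le.1 (h l)).2])
    calc a l * Real.exp (s' l) ≤ a l * (Real.exp η * Real.exp (s l)) :=
          mul_le_mul_of_nonneg_left this (ha l)
      _ = _ := by ring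
  have h2 : ∑ l, a l * Real.exp (s l) ≤ Real.exp η * ∑ l, a l * Real.exp (s' l) := by
    rw [Finset.mul_sum]
    refine Finset.sum_le_sum fun l _ => ?_
    have : Real.exp (s l) ≤ Real.exp η * Real.exp (s' l) := by
      rw [← Real.exp_add]; exact Real.exp_le_exp.2 (by linarith [(abs_le.1 (h l)).1])
    calc a l * Real.exp (s l) ≤ a l * (Real.exp η * Real.exp (s' l)) :=
          mul_le_mul_of_nonneg_left this (ha l)
      _ = _ := by ring
  have hexp : Real.exp (2 * η) = Real.exp η * Real.exp η := by rw [← Real.exp_add]; ring_nf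
  rw [maskedSoftmax, maskedSoftmax, mul_div_assoc', div_le_div_iff₀ hZ' hZ, hexp]
  have h0 : 0 ≤ a l * Real.exp (s l) := mul_nonneg (ha l) (Real.exp_pos _).le
  calc a l * Real.exp (s' l) * ∑ l, a l * Real.exp (s l)
      ≤ Real.exp η * (a l * Real.exp (s l)) * (Real.exp η * ∑ l, a l * Real.exp (s' l)) := by
        gcongr
    _ = _ := by ring

lemma sum_abs_maskedSoftmax_sub_le (ha : ∀ l, 0 ≤ a l) (ha' : ∃ l, 0 < a l) {s s' : Fin T → ℝ}
    {η : ℝ} (hη : 0 ≤ η) (hη' : η ≤ 1 / 2) (h : ∀ l, |s' l - s l| ≤ η) :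
    ∑ l, |maskedSoftmax s' a l - maskedSoftmax s a l| ≤ 4 * η := by
  have hE1 : 1 ≤ Real.exp (2 * η) := Real.one_le_exp (by linarith)
  have hE : Real.exp (2 * η) - 1 ≤ 4 * η := by
    have h1 := (abs_le.1 (Real.abs_exp_sub_one_sub_id_le (x := 2 * η)
      (by rw [abs_of_nonneg (by linarith)]; linarith))).2
    nlinarith
  have hpt : ∀ l, |maskedSoftmax s' a l - maskedSoftmax s a l|
      ≤ (Real.exp (2 * η) - 1) * maskedSoftmax s a l := by
    intro l
    have h1 := maskedSoftmax_le_exp_mul ha ha' h l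
    have h2 := maskedSoftmax_le_exp_mul ha ha' (s := s') (s' := s)
      (fun l => by rw [abs_sub_comm]; exact h l) l
    have h3 := maskedSoftmax_nonneg ha s l
    rw [abs_le]
    constructor
    -- With `E = exp (2 * η)`, the lower bound `2 - E ≤ 1 / E` is `(E - 1) ^ 2 ≥ 0`.
    · have h4 : maskedSoftmax s a l - (Real.exp (2 * η) - 1) * maskedSoftmax s a l
          ≤ maskedSoftmax s' a l := by
        refine le_of_mul_le_mul_left ?_ (Real.exp_pos (2 * η))
        nlinarith [mul_nonneg h3 (sq_nonneg (Real.exp (2 * η) - 1))]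
      linarith
    · linarith
  calc ∑ l, |maskedSoftmax s' a l - maskedSoftmax s a l|
      ≤ ∑ l, (Real.exp (2 * η) - 1) * maskedSoftmax s a l := Finset.sum_le_sum fun l _ => hpt l
    _ = Real.exp (2 * η) - 1 := by rw [← Finset.mul_sum, sum_maskedSoftmax ha ha', mul_one]
    _ ≤ _ := hE

lemma l2norm_vecMul_rows_le {d : ℕ} {X : Matrix (Fin T) (Fin d) ℝ} {α : ℝ}
    (hX : ∀ i, l2norm (X i) ≤ α) (p : Fin T → ℝ) : l2norm (p ᵥ* X) ≤ (∑ l, |p l|) * α := by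
  rw [Matrix.vecMul_eq_sum, Finset.sum_mul]
  refine (l2norm_sum_le _ _).trans (Finset.sum_le_sum fun l _ => ?_)
  rw [l2norm_smul]
  exact mul_le_mul_of_nonneg_left (hX l) (abs_nonneg _)

end Softmax

/-! ### Stability of attention -/

namespace MHAWeights

variable {H d₁ d₂ k v k' v' T : ℕ}

/-- The bilinear form by which the `j`-th head scores pairs of tokens. -/
noncomputable def scoreForm (W : MHAWeights H d₁ d₂ k v) (j : Fin H) :
    Matrix (Fin d₁) (Fin d₁) ℝ := (√k)⁻¹ • (W.WQ j * (W.WK j)ᵀ)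

/-- The linear map from tokens to outputs in the `j`-th head. -/
def outputMap (W : MHAWeights H d₁ d₂ k v) (j : Fin H) : Matrix (Fin d₁) (Fin d₂) ℝ :=
  W.WV j * W.WO j

lemma head_vecMul_WO (W : MHAWeights H d₁ d₂ k v) (X : Matrix (Fin T) (Fin d₁) ℝ)
    (a : Matrix (Fin T) (Fin T) ℝ) (i : Fin T) (j : Fin H) :
    W.head X a i j ᵥ* W.WO j =
      (maskedSoftmax (fun l => (X i ᵥ* W.scoreForm j) ⬝ᵥ X l) (a i) ᵥ* X) ᵥ* W.outputMap j := by
  have hs : (√k)⁻¹ • ((X i ᵥ* W.WQ j) ᵥ* (X * W.WK j)ᵀ)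
      = fun l => (X i ᵥ* W.scoreForm j) ⬝ᵥ X l := by
    funext l
    rw [scoreForm, Matrix.transpose_mul, ← Matrix.vecMul_vecMul, Matrix.vecMul_vecMul (X i),
      Matrix.vecMul_smul, smul_dotProduct]
    rfl
  rw [head, hs, outputMap, ← Matrix.vecMul_vecMul, ← Matrix.vecMul_vecMul]

lemma SpectralNormLeOne.abs_scoreForm_le {W : MHAWeights H d₁ d₂ k v} (hW : W.SpectralNormLeOne)
    (hk : 0 < k) (j : Fin H) (r s : Fin d₁) : |W.scoreForm j r s| ≤ 1 := by
  obtain ⟨hQ, hK, -, -⟩ := hW j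
  have h1 : |(W.WQ j * (W.WK j)ᵀ) r s| ≤ 1 := by
    refine (abs_apply_le_l2_opNorm _ r s).trans ((Matrix.l2_opNorm_mul _ _).trans ?_)
    rw [l2_opNorm_transpose]
    exact mul_le_one₀ hQ (norm_nonneg _) hK
  have hk1 : (1 : ℝ) ≤ √k := Real.one_le_sqrt.2 (by exact_mod_cast hk)
  rw [scoreForm, Matrix.smul_apply, smul_eq_mul, abs_mul, abs_of_nonneg (by positivity)]
  exact mul_le_one₀ (inv_le_one_of_one_le₀ hk1) (abs_nonneg _) h1

lemma SpectralNormLeOne.norm_outputMap_le {W : MHAWeights H d₁ d₂ k v}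
    (hW : W.SpectralNormLeOne) (j : Fin H) : ‖W.outputMap j‖ ≤ 1 :=
  (Matrix.l2_opNorm_mul _ _).trans (mul_le_one₀ (hW j).2.2.1 (norm_nonneg _) (hW j).2.2.2)

/-- Stability of attention under entrywise perturbation of its score forms and output maps. -/
lemma norm_attn_sub_attn_le {W : MHAWeights H d₁ d₂ k v} {W' : MHAWeights H d₁ d₂ k' v'}
    {bK bV α : ℝ} (hbK : 0 ≤ bK) (hbV : 0 ≤ bV) (hα : 0 ≤ α)
    (hK : ∀ j r s, |W'.scoreForm j r s - W.scoreForm j r s| ≤ bK)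
    (hV : ∀ j r s, |W'.outputMap j r s - W.outputMap j r s| ≤ bV)
    (hnorm : ∀ j, ‖W.outputMap j‖ ≤ 1) (hsmall : bK * d₁ * α * α ≤ 1 / 2)
    {X : Matrix (Fin T) (Fin d₁) ℝ} {a : Matrix (Fin T) (Fin T) ℝ}
    (hX : ∀ i, l2norm (X i) ≤ α) (ha : IsAttentionMask a) (i : Fin T) :
    ‖W'.attn X a i - W.attn X a i‖ ≤
      H * (4 * (bK * d₁ * α * α) * α + √d₂ * (bV * (√d₁ * α))) := by
  have ha0 : ∀ l, 0 ≤ a i l := fun l => by rcases ha.1 i l with h | h <;> simp [h]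
  have ha1 : ∃ l, 0 < a i l := (ha.2 i).imp fun l hl => by simp [hl]
  have hsub : W'.attn X a i - W.attn X a i = WithLp.toLp 2
      (∑ j, (W'.head X a i j ᵥ* W'.WO j - W.head X a i j ᵥ* W.WO j)) := by
    rw [attn, attn, ← WithLp.toLp_sub, Finset.sum_sub_distrib]
  rw [hsub]
  refine (l2norm_sum_le _ _).trans ?_
  have hbound : ∀ j, l2norm (W'.head X a i j ᵥ* W'.WO j - W.head X a i j ᵥ* W.WO j)
      ≤ 4 * (bK * d₁ * α * α) * α + √d₂ * (bV * (√d₁ * α)) := by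
    intro j
    rw [head_vecMul_WO, head_vecMul_WO]
    set p' := maskedSoftmax (fun l => (X i ᵥ* W'.scoreForm j) ⬝ᵥ X l) (a i)
    set p := maskedSoftmax (fun l => (X i ᵥ* W.scoreForm j) ⬝ᵥ X l) (a i)
    have hp : ∑ l, |p' l - p l| ≤ 4 * (bK * d₁ * α * α) := by
      refine sum_abs_maskedSoftmax_sub_le ha0 ha1 (by positivity) hsmall fun l => ?_
      rw [← sub_dotProduct, ← Matrix.vecMul_sub]
      refine (abs_vecMul_dotProduct_le hbK (fun r s => hK j r s) _ _).trans ?_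
      have h1 := hX i
      have h2 := hX l
      have h3 := l2norm_nonneg (X l)
      gcongr
    have hp' : ∑ l, |p' l| = 1 := by
      rw [← sum_maskedSoftmax ha0 ha1 fun l => (X i ᵥ* W'.scoreForm j) ⬝ᵥ X l]
      exact Finset.sum_congr rfl fun l _ => abs_of_nonneg (maskedSoftmax_nonneg ha0 _ l)
    -- The first term uses the target's norm bound, the second that `p'` is a probability vector; no
    -- norm bound on the perturbed weights is needed.
    have hsplit : (p' ᵥ* X) ᵥ* W'.outputMap j - (p ᵥ* X) ᵥ* W.outputMap j =
        ((p' - p) ᵥ* X) ᵥ* W.outputMap j + (p' ᵥ* X) ᵥ* (W'.outputMap j - W.outputMap j) := by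
      rw [Matrix.sub_vecMul, Matrix.sub_vecMul, Matrix.vecMul_sub]; abel
    rw [hsplit]
    refine (l2norm_add_le _ _).trans (add_le_add ?_ ?_)
    · refine (l2norm_vecMul_le _ _).trans ?_
      calc ‖W.outputMap j‖ * l2norm ((p' - p) ᵥ* X) ≤ 1 * ((∑ l, |p' l - p l|) * α) := by
            gcongr
            · exact l2norm_nonneg _
            · exact hnorm j
            · exact l2norm_vecMul_rows_le hX (p' - p)
        _ ≤ _ := by rw [one_mul]; gcongr
    · refine (l2norm_vecMul_le_of_abs_le hbV (fun r s => hV j r s) _).trans ?_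
      gcongr
      refine (l2norm_vecMul_rows_le hX p').trans ?_
      rw [hp', one_mul]
  refine (Finset.sum_le_sum fun j _ => hbound j).trans_eq ?_
  rw [Finset.sum_const, Finset.card_univ, Fintype.card_fin, nsmul_eq_mul]

end MHAWeights

/-! ### Column groups and pruning masks -/

lemma exists_balanced_grouping {d : ℕ} (hd : 0 < d) (n : ℕ) :
    ∃ g : Fin n → Fin d, ∀ r, n / d ≤ (Finset.univ.filter fun c => g c = r).card := by
  have e : (Fin d × Fin (n / d)) ↪ Fin n :=
    (Function.Embedding.nonempty_of_card_le (by simpa using Nat.mul_div_le n d)).some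
  -- Leftover columns go to group `0`; only lower bounds on group sizes matter.
  refine ⟨Function.extend e Prod.fst fun _ => ⟨0, hd⟩, fun r => ?_⟩
  calc n / d = (Finset.univ.image fun t => e (r, t)).card := by
        rw [Finset.card_image_of_injective _ fun t t' h => (Prod.ext_iff.1 (e.injective h)).2]
        simp
    _ ≤ _ := Finset.card_le_card fun c hc => by
        obtain ⟨t, -, rfl⟩ := Finset.mem_image.1 hc
        simp [e.injective.extend_apply]

/-- Rounding down loses less than `1`, which `40 * log L ≥ 20` absorbs. -/
lemma mul_log_le_div {d n : ℕ} (hd : 0 < d) {L : ℝ} (hL : 2 ≤ L)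
    (hn : (d : ℝ) * 1200 * Real.log L ≤ n) : 1160 * Real.log L ≤ (n / d : ℕ) := by
  have hlog := half_le_log hL
  have h1 : (n : ℝ) < d * ((n / d : ℕ) + 1) := by exact_mod_cast Nat.lt_mul_div_succ n hd
  have hd' : (0 : ℝ) < d := by exact_mod_cast hd
  have h2 : 1200 * Real.log L < (n / d : ℕ) + 1 := by
    refine lt_of_mul_lt_mul_left ?_ hd'.le
    linarith
  linarith

namespace MHAWeights

variable {H d₁ d₂ k v : ℕ}

/-- The masks that keep in the query and value projections only the columns whose group is the given
row, and in the key and output projections the chosen subsets of every group. -/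
def groupMask (gK : Fin k → Fin d₁) (gV : Fin v → Fin d₁)
    (SK : Fin H → Fin d₁ → Fin d₁ → Finset (Fin k))
    (SV : Fin H → Fin d₁ → Fin d₂ → Finset (Fin v)) : MHAWeights H d₁ d₂ k v where
  WQ _ r c := if gK c = r then 1 else 0
  WK j s c := if c ∈ SK j (gK c) s then 1 else 0
  WV _ r c := if gV c = r then 1 else 0
  WO j c s := if c ∈ SV j (gV c) s then 1 else 0

variable {gK : Fin k → Fin d₁} {gV : Fin v → Fin d₁}
  {SK : Fin H → Fin d₁ → Fin d₁ → Finset (Fin k)} {SV : Fin H → Fin d₁ → Fin d₂ → Finset (Fin v)}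

lemma isBinary_groupMask : (groupMask gK gV SK SV).IsBinary := by
  rintro (⟨j, r, c⟩ | ⟨j, r, c⟩ | ⟨j, r, c⟩ | ⟨j, r, c⟩) <;> simp only [entry, groupMask] <;>
    split_ifs <;> simp

/-- A column survives in row `r` of the first factor only if its group is `r`, so the subset chosen
for one row never affects another. -/
lemma sum_ite_mul_ite_eq_sum {n d : ℕ} {g : Fin n → Fin d} {S : Fin d → Finset (Fin n)} {r : Fin d}
    (hS : S r ⊆ Finset.univ.filter fun c => g c = r) (x y : Fin n → ℝ) :
    ∑ c, x c * (if g c = r then 1 else 0) * (y c * if c ∈ S (g c) then 1 else 0)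
      = ∑ c ∈ S r, x c * y c := by
  rw [← Finset.sum_filter_add_sum_filter_not Finset.univ (fun c => c ∈ S r),
    Finset.filter_mem_eq_inter,
    Finset.univ_inter]
  have h0 : ∑ c ∈ Finset.univ.filter (fun c => c ∉ S r),
      x c * (if g c = r then 1 else 0) * (y c * if c ∈ S (g c) then 1 else 0) = 0 := by
    refine Finset.sum_eq_zero fun c hc => ?_
    by_cases h : g c = r
    · simp [h, (Finset.mem_filter.1 hc).2]
    · simp [h]
  rw [h0, add_zero]
  refine Finset.sum_congr rfl fun c hc => ?_
  have h : g c = r := (Finset.mem_filter.1 (hS hc)).2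
  simp [h, hc]

lemma scoreForm_prune_groupMask (W : MHAWeights H d₁ d₂ k v) {j : Fin H} {r s : Fin d₁}
    (hS : SK j r s ⊆ Finset.univ.filter fun c => gK c = r) :
    (W.prune (groupMask gK gV SK SV)).scoreForm j r s
      = (√k)⁻¹ * ∑ c ∈ SK j r s, W.WQ j r c * W.WK j s c :=
  congrArg ((√k)⁻¹ * ·) (sum_ite_mul_ite_eq_sum (S := fun r => SK j r s) hS _ _)

lemma outputMap_prune_groupMask (W : MHAWeights H d₁ d₂ k v) {j : Fin H} {r : Fin d₁} {s : Fin d₂}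
    (hS : SV j r s ⊆ Finset.univ.filter fun c => gV c = r) :
    (W.prune (groupMask gK gV SK SV)).outputMap j r s
      = ∑ c ∈ SV j r s, W.WV j r c * W.WO j c s :=
  sum_ite_mul_ite_eq_sum (S := fun r => SV j r s) hS _ _

/-! ### Random weights and the union bound -/

section RandomInit

variable {Ω : Type*} [MeasurableSpace Ω] {P : Measure Ω}
  {Ws : Ω → MHAWeights H d₁ d₂ k v}

lemma IsRandomInit.aemeasurable (h : IsRandomInit P Ws) (hk : 0 < k) (e : MHAIndex H d₁ d₂ k v) :
    AEMeasurable (fun ω => (Ws ω).entry e) P := by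
  have hk' : (0 : ℝ) < (k : ℝ) ^ (1 / 4 : ℝ) := Real.rpow_pos_of_pos (by exact_mod_cast hk) _
  cases e with
  | query j r c => exact aemeasurable_of_isUniform_Icc hk' (h.2 (.query j r c))
  | key j r c => exact aemeasurable_of_isUniform_Icc hk' (h.2 (.key j r c))
  | value j r c => exact aemeasurable_of_isUniform_Icc one_pos (h.2 (.value j r c))
  | output j r c => exact aemeasurable_of_isUniform_Icc one_pos (h.2 (.output j r c))

lemma IsRandomInit.measure_no_score_approx_le [IsProbabilityMeasure P]
    (h : IsRandomInit P Ws) (hk : 0 < k)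
    (j : Fin H) (r s : Fin d₁) {L : ℝ} (hL : 2 ≤ L) {G : Finset (Fin k)}
    (hG : 1160 * Real.log L ≤ G.card) {z : ℝ} (hz : |z| ≤ 1) :
    P {ω | ∀ S ⊆ G, 1 / L < |(√k)⁻¹ * ∑ c ∈ S, (Ws ω).WQ j r c * (Ws ω).WK j s c - z|}
      ≤ ENNReal.ofReal (1 / L) := by
  have hk' : (0 : ℝ) < (k : ℝ) ^ (1 / 4 : ℝ) := Real.rpow_pos_of_pos (by exact_mod_cast hk) _
  -- The initialization radius squared is exactly the attention scaling `√k`.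
  have hsq : ((k : ℝ) ^ (1 / 4 : ℝ)) ^ 2 = √k := by
    rw [← Real.rpow_natCast, ← Real.rpow_mul (by positivity), Real.sqrt_eq_rpow]
    norm_num
  rw [← hsq]
  exact measure_no_subsetSum_mul_le h.1 (h.aemeasurable hk)
    (p := fun c => .query j r c) (q := fun c => .key j s c)
    (fun c c' hc => by injection hc) (fun c c' hc => by injection hc)
    (fun c c' hc => by injection hc) hk' (fun c => h.2 (.query j r c))
    (fun c => h.2 (.key j s c)) hL hG hz

lemma IsRandomInit.measure_no_output_approx_le [IsProbabilityMeasure P]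
    (h : IsRandomInit P Ws) (hk : 0 < k)
    (j : Fin H) (r : Fin d₁) (s : Fin d₂) {L : ℝ} (hL : 2 ≤ L) {G : Finset (Fin v)}
    (hG : 1160 * Real.log L ≤ G.card) {z : ℝ} (hz : |z| ≤ 1) :
    P {ω | ∀ S ⊆ G, 1 / L < |∑ c ∈ S, (Ws ω).WV j r c * (Ws ω).WO j c s - z|}
      ≤ ENNReal.ofReal (1 / L) := by
  have := measure_no_subsetSum_mul_le h.1 (h.aemeasurable hk)
    (p := fun c => .value j r c) (q := fun c => .output j c s)
    (fun c c' hc => by injection hc) (fun c c' hc => by injection hc)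
    (fun c c' hc => by injection hc) one_pos (fun c => h.2 (.value j r c))
    (fun c => h.2 (.output j c s)) hL hG hz
  simpa only [one_pow, inv_one, one_mul, entry] using this

/-- With high probability some pruning of a random weight set approximates the score forms and output
maps of a fixed weight set. -/
lemma IsRandomInit.measure_no_pruning_le [IsProbabilityMeasure P] {dK dV : ℕ}
    {Wt : MHAWeights H d₁ d₂ dK dV}
    (hWt : Wt.SpectralNormLeOne) (hdK : 0 < dK) (hd₁ : 0 < d₁)
    (h : IsRandomInit P Ws) (hk : 0 < k) {LK LV : ℝ} (hLK : 2 ≤ LK) (hLV : 2 ≤ LV)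
    (hnK : (d₁ : ℝ) * 1200 * Real.log LK ≤ k) (hnV : (d₁ : ℝ) * 1200 * Real.log LV ≤ v) :
    P {ω | ∃ M : MHAWeights H d₁ d₂ k v, M.IsBinary ∧
        (∀ j r s, |((Ws ω).prune M).scoreForm j r s - Wt.scoreForm j r s| ≤ 1 / LK) ∧
        ∀ j r s, |((Ws ω).prune M).outputMap j r s - Wt.outputMap j r s| ≤ 1 / LV}ᶜ
      ≤ ENNReal.ofReal (H * d₁ * d₁ * (1 / LK) + H * d₁ * d₂ * (1 / LV)) := by
  obtain ⟨gK, hgK⟩ := exists_balanced_grouping hd₁ k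
  obtain ⟨gV, hgV⟩ := exists_balanced_grouping hd₁ v
  have hGK : ∀ r, 1160 * Real.log LK ≤ (Finset.univ.filter fun c => gK c = r).card := fun r =>
    (mul_log_le_div hd₁ hLK hnK).trans (by exact_mod_cast hgK r)
  have hGV : ∀ r, 1160 * Real.log LV ≤ (Finset.univ.filter fun c => gV c = r).card := fun r =>
    (mul_log_le_div hd₁ hLV hnV).trans (by exact_mod_cast hgV r)
  set badK : Fin H × Fin d₁ × Fin d₁ → Set Ω := fun i =>
    {ω | ∀ S ⊆ Finset.univ.filter fun c => gK c = i.2.1, 1 / LK <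
      |(√k)⁻¹ * ∑ c ∈ S, (Ws ω).WQ i.1 i.2.1 c * (Ws ω).WK i.1 i.2.2 c
        - Wt.scoreForm i.1 i.2.1 i.2.2|} with hbadK
  set badV : Fin H × Fin d₁ × Fin d₂ → Set Ω := fun i =>
    {ω | ∀ S ⊆ Finset.univ.filter fun c => gV c = i.2.1, 1 / LV <
      |∑ c ∈ S, (Ws ω).WV i.1 i.2.1 c * (Ws ω).WO i.1 c i.2.2
        - Wt.outputMap i.1 i.2.1 i.2.2|} with hbadV
  have hsub : {ω | ∃ M : MHAWeights H d₁ d₂ k v, M.IsBinary ∧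
        (∀ j r s, |((Ws ω).prune M).scoreForm j r s - Wt.scoreForm j r s| ≤ 1 / LK) ∧
        ∀ j r s, |((Ws ω).prune M).outputMap j r s - Wt.outputMap j r s| ≤ 1 / LV}ᶜ
      ⊆ (⋃ i, badK i) ∪ ⋃ i, badV i := by
    intro ω hω
    by_contra hno
    rw [Set.mem_union, not_or] at hno
    simp only [Set.mem_iUnion, not_exists, hbadK, hbadV, Set.mem_ofPred_eq, not_forall, not_lt,
      Prod.forall] at hno
    obtain ⟨hK, hV⟩ := hno
    -- Outside all bad events every entry has its subset, and these assemble into one mask. Events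
    -- for different entries may be dependent.
    choose SK hSK hSK' using hK
    choose SV hSV hSV' using hV
    refine hω ⟨groupMask gK gV SK SV, isBinary_groupMask, fun j r s => ?_, fun j r s => ?_⟩
    · rw [scoreForm_prune_groupMask _ (hSK j r s)]; exact hSK' j r s
    · rw [outputMap_prune_groupMask _ (hSV j r s)]; exact hSV' j r s
  have hKle : P (⋃ i, badK i) ≤ ENNReal.ofReal (H * d₁ * d₁ * (1 / LK)) := by
    refine (measure_iUnion_fintype_le _ _).trans ((Finset.sum_le_sum fun i _ =>
      h.measure_no_score_approx_le hk i.1 i.2.1 i.2.2 hLK (hGK i.2.1)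
        (hWt.abs_scoreForm_le hdK i.1 i.2.1 i.2.2)).trans_eq ?_)
    rw [Finset.sum_const, ← ENNReal.ofReal_nsmul]
    simp [mul_assoc]
  have hVle : P (⋃ i, badV i) ≤ ENNReal.ofReal (H * d₁ * d₂ * (1 / LV)) := by
    refine (measure_iUnion_fintype_le _ _).trans ((Finset.sum_le_sum fun i _ =>
      h.measure_no_output_approx_le hk i.1 i.2.1 i.2.2 hLV (hGV i.2.1)
        ((abs_apply_le_l2_opNorm _ i.2.1 i.2.2).trans (hWt.norm_outputMap_le i.1))).trans_eq ?_)
    rw [Finset.sum_const, ← ENNReal.ofReal_nsmul]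
    simp [mul_assoc]
  refine (measure_mono hsub).trans ((measure_union_le _ _).trans ?_)
  rw [ENNReal.ofReal_add (by positivity) (by positivity)]
  exact add_le_add hKle hVle

end RandomInit

end MHAWeights

/-! ### Choice of accuracies and conclusion -/

theorem mainTheorem1 :
    ∃ C : ℝ, 0 < C ∧
      ∀ (H d₁ d₂ dK dV nK nV : ℕ), 0 < H → 0 < d₁ → 0 < d₂ → 0 < dK → 0 < dV →
      ∀ (α ε : ℝ), max (Real.sqrt d₁) (Real.sqrt d₂) ≤ α → 0 < ε → ε < 1 →
        (nK : ℝ) ≥ d₁ * C * Real.log (8 * H * α ^ 3 * (d₁ : ℝ) ^ (3 / 2 : ℝ) / ε) →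
        (nV : ℝ) ≥ d₁ * C * Real.log (2 * H * α * d₁ * Real.sqrt d₂ / ε) →
      ∀ (Wt : MHAWeights H d₁ d₂ dK dV), Wt.SpectralNormLeOne →
      ∀ {Ω : Type*} [MeasurableSpace Ω] (P : Measure Ω) [IsProbabilityMeasure P]
        (Ws : Ω → MHAWeights H d₁ d₂ nK nV), MHAWeights.IsRandomInit P Ws →
        ENNReal.ofReal (1 - ε) ≤
          P {ω | ∃ M : MHAWeights H d₁ d₂ nK nV, M.IsBinary ∧
            ∀ (T : ℕ) (X : Matrix (Fin T) (Fin d₁) ℝ) (a : Matrix (Fin T) (Fin T) ℝ),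
              (∀ i, ‖(WithLp.toLp 2 (X i) : EuclideanSpace ℝ (Fin d₁))‖ ≤ α) →
              IsAttentionMask a →
              ∀ i, ‖((Ws ω).prune M).attn X a i - Wt.attn X a i‖ ≤ ε} := by
  refine ⟨1200, by norm_num, ?_⟩
  intro H d₁ d₂ dK dV nK nV hH hd₁ hd₂ hdK _ α ε hα hε hε1 hnK hnV Wt hWt Ω _ P _ Ws hWs
  have hH1 : (1 : ℝ) ≤ H := by exact_mod_cast hH
  have hD1 : (1 : ℝ) ≤ d₁ := by exact_mod_cast hd₁
  have hD2 : (1 : ℝ) ≤ d₂ := by exact_mod_cast hd₂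
  have hpow : (d₁ : ℝ) ^ (3 / 2 : ℝ) = d₁ * √d₁ := by
    rw [Real.sqrt_eq_rpow, ← Real.rpow_one_add' (by positivity) (by norm_num)]
    norm_num
  rw [hpow] at hnK
  have hq1 : (√d₁ : ℝ) ^ 2 = d₁ := Real.sq_sqrt (by positivity)
  have hq2 : (√d₂ : ℝ) ^ 2 = d₂ := Real.sq_sqrt (by positivity)
  have hs1 : (1 : ℝ) ≤ √d₁ := Real.one_le_sqrt.2 hD1
  have hs2 : (1 : ℝ) ≤ √d₂ := Real.one_le_sqrt.2 hD2
  have hα1 : √d₁ ≤ α := (le_max_left _ _).trans hα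
  have hα2 : √d₂ ≤ α := (le_max_right _ _).trans hα
  set D := (d₁ : ℝ)
  set D' := (d₂ : ℝ)
  set h := (H : ℝ)
  set q := √D
  set q' := √D'
  have hα0 : 1 ≤ α := hs1.trans hα1
  set LK := 8 * h * α ^ 3 * (D * q) / ε with hLKdef
  set LV := 2 * h * α * D * q' / ε with hLVdef
  have hLK : 2 ≤ LK := by
    rw [hLKdef, le_div_iff₀ hε]
    have : (1 : ℝ) ≤ h * α ^ 3 * (D * q) :=
      one_le_mul_of_one_le_of_one_le
        (one_le_mul_of_one_le_of_one_le hH1 (one_le_pow₀ hα0))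
        (one_le_mul_of_one_le_of_one_le hD1 hs1)
    linarith
  have hLV : 2 ≤ LV := by
    rw [hLVdef, le_div_iff₀ hε]
    have : (1 : ℝ) ≤ h * α * D * q' :=
      one_le_mul_of_one_le_of_one_le (one_le_mul_of_one_le_of_one_le
        (one_le_mul_of_one_le_of_one_le hH1 hα0) hD1) hs2
    linarith
  have hnK0 : 0 < nK := by
    have : (0 : ℝ) < nK := lt_of_lt_of_le
      (by have := half_le_log hLK; positivity) hnK
    exact_mod_cast this
  -- Here and in `hprobV`, `α ≥ √d₁` and `α ≥ √d₂` let the entry counts fit into the failure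
  -- probability.
  have hprobK : h * D * D * (1 / LK) ≤ ε / 2 := by
    have e : h * D * D * (1 / LK) = ε * (D / (8 * (α ^ 3 * q))) := by
      rw [hLKdef]; field_simp
    rw [e, show ε / 2 = ε * (1 / 2) by ring]
    refine mul_le_mul_of_nonneg_left ?_ hε.le
    rw [div_le_iff₀ (by positivity)]
    have h1 : D ≤ α ^ 2 := by rw [← hq1]; gcongr
    have h2 : α ^ 2 * 1 ≤ α ^ 2 * (α * q) := by
      gcongr; exact one_le_mul_of_one_le_of_one_le hα0 hs1
    nlinarith
  have hprobV : h * D * D' * (1 / LV) ≤ ε / 2 := by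
    have e : h * D * D' * (1 / LV) = ε / 2 * (q' / α) := by
      rw [hLVdef, ← hq2]; field_simp
    rw [e]
    exact mul_le_of_le_one_right (by positivity) ((div_le_one (by positivity)).2 hα2)
  have herrK : h * (4 * (1 / LK * D * α * α) * α) ≤ ε / 2 := by
    have e : h * (4 * (1 / LK * D * α * α) * α) = ε / 2 * (1 / q) := by
      rw [hLKdef]; field_simp; norm_num
    rw [e]
    exact mul_le_of_le_one_right (by positivity) ((div_le_one (by positivity)).2 hs1)
  have herrV : h * (q' * (1 / LV * (q * α))) ≤ ε / 2 := by
    have e : h * (q' * (1 / LV * (q * α))) = ε / 2 * (1 / q) := by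
      rw [hLVdef, ← hq1]; field_simp
    rw [e]
    exact mul_le_of_le_one_right (by positivity) ((div_le_one (by positivity)).2 hs1)
  -- The softmax estimate needs score errors at most `1 / 2`; this follows from `herrK`.
  have hsmall : 1 / LK * D * α * α ≤ 1 / 2 := by
    have h0 : 0 ≤ 1 / LK * D * α * α := by positivity
    have h1 : 1 / LK * D * α * α ≤ h * (1 / LK * D * α * α * α) :=
      (le_mul_of_one_le_right h0 hα0).trans (le_mul_of_one_le_left (by positivity) hH1)
    nlinarith
  have hbad := hWs.measure_no_pruning_le hWt hdK hd₁ hnK0 hLK hLV hnK hnV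
  set good : Set Ω := {ω | ∃ M : MHAWeights H d₁ d₂ nK nV, M.IsBinary ∧
        (∀ j r s, |((Ws ω).prune M).scoreForm j r s - Wt.scoreForm j r s| ≤ 1 / LK) ∧
        ∀ j r s, |((Ws ω).prune M).outputMap j r s - Wt.outputMap j r s| ≤ 1 / LV}
  have hgood : ENNReal.ofReal (1 - ε) ≤ P good := by
    -- Subadditivity replaces the complement rule, so measurability of `good` is not needed.
    have h1 : 1 ≤ P good + P goodᶜ := by
      rw [← measure_univ (μ := P), ← Set.union_compl_self good]
      exact measure_union_le _ _
    rw [ENNReal.ofReal_sub _ hε.le, ENNReal.ofReal_one, tsub_le_iff_right]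
    refine h1.trans (add_le_add le_rfl (hbad.trans (ENNReal.ofReal_le_ofReal ?_)))
    linarith
  refine hgood.trans (measure_mono ?_)
  rintro ω ⟨M, hM, hK, hV⟩
  refine ⟨M, hM, fun T X a hX ha i => ?_⟩
  refine (MHAWeights.norm_attn_sub_attn_le (by positivity) (by positivity) (by positivity) hK hV
    hWt.norm_outputMap_le hsmall hX ha i).trans ?_
  rw [mul_add]
  linarith
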